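/- For $n\ge 2$ and $p\in[2,\infty]$ (with the conventions $1/p=0$, $(p-2)/p=1$, $p/(p-2)=1$ for $p=\infty$, and $p/(p-2)=\infty$ for $p=2$), define $\lambda_1>\lambda_2\ge\dots\ge\lambda_n$ by $$\lambda_n=3\sqrt n,\qquad \lambda_1-\lambda_{j+1}=\frac{j^{(p-2)/p}\,n^{1/p}}{\log^2 n}\quad(1\le j\le n-1),$$ (so $\lambda_1=3\sqrt n+(n-1)^{(p-2)/p}n^{1/p}/\log^2 n$), and let $d(\lambda)\in\mathbb R^{n-1}$ be the vector with entries $[d(\lambda)]_j=1/(\lambda_1-\lambda_{j+1})$. Let $A=\mathrm{diag}(\lambda_1,\dots,\lambda_n)$ and $A_0=\mathrm{diag}(\lambda_2,\dots,\lambda_n)$. Let $G$ be a GOE matrix of size $n-1$, i.e. a real symmetric random matrix whose entries on and above the diagonal are jointly independent, with off-diagonal entries $N(0,1)$ and diagonal entries $N(0,2)$. Let $E=\begin{pmatrix}0&0\\0&G\end{pmatrix}$ be the $n\times n$ matrix with zero first row and column and bottom right block $G$, and $\tilde A=A+E$. **Theorem.** There are absolute constants $N\in\mathbb N$ and $C,c_1,c_2>0$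 such that for all $n>N$ (with $n\ge2$) and all $p\in[2,\infty]$: 1. $c_1\log^{3-2/p}n\le n^{1/p}\,\|d(\lambda)\|_{p/(p-2)}\le c_2\log^{3-2/p}n$; 2. with probability at least $1-C/n$, $\lambda_{\max}(A_0+G)>\lambda_1$ and, consequently, every leading eigenvector $\tilde u_1$ of $\tilde A$ (an eigenvector for the largest eigenvalue) is orthogonal to every leading eigenvector $u_1$ of $A$ (i.e. $\tilde u_1\perp e_1$). -/

import Mathlib

open MeasureTheory ProbabilityTheory
open scoped ENNReal

noncomputable section

namespace GOEExample

/-- The largest eigenvalue `λ_max(M)` of a real symmetric matrix (whose spectrum is a finite set,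
nonempty as soon as the index type is). -/
def lambdaMax {k : ℕ} (M : Matrix (Fin k) (Fin k) ℝ) : ℝ :=
  sSup (spectrum ℝ M)

/-- `v` is a leading eigenvector of `M`: a nonzero vector with `M v = λ_max(M) v`. -/
def IsLeadingEigenvector {k : ℕ} (M : Matrix (Fin k) (Fin k) ℝ)
    (v : EuclideanSpace ℝ (Fin k)) : Prop :=
  Module.End.HasEigenvector (Matrix.toEuclideanLin M) (lambdaMax M) v

/-- `G` is a random matrix from the GOE of size `m`: it is symmetric, the entries on and above the
diagonal are jointly independent, off-diagonal entries have law `N(0,1)` and diagonal entries have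
law `N(0,2)` (the second parameter of `gaussianReal` is the variance). -/
structure IsGOE {Ω : Type*} [MeasurableSpace Ω] {m : ℕ}
    (G : Ω → Matrix (Fin m) (Fin m) ℝ) (μ : Measure Ω) : Prop where
  symm : ∀ ω, (G ω).IsSymm
  indep : iIndepFun
    (fun (e : {e : Fin m × Fin m // e.1 ≤ e.2}) (ω : Ω) => G ω e.1.1 e.1.2) μ
  offDiag : ∀ j k, j ≠ k → HasLaw (fun ω => G ω j k) (gaussianReal 0 1) μ
  diag : ∀ j, HasLaw (fun ω => G ω j j) (gaussianReal 0 2) μ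

/-- `1 / p` as a real number, for `p ∈ [2, ∞]` (so `1 / ∞ = 0`). -/
def invExp (p : ℝ≥0∞) : ℝ := (p⁻¹).toReal

/-- The conjugate-type exponent `p / (p - 2) = (1 - 2 / p)⁻¹ ∈ [1, ∞]` for `p ∈ [2, ∞]`; it is
`∞` for `p = 2` and `1` for `p = ∞`. -/
def normExp (p : ℝ≥0∞) : ℝ≥0∞ := (1 - 2 / p)⁻¹

/-- The gaps of the example: for `1 ≤ j ≤ n - 1`, the number
`λ₁ - λ_{j+1} = j^{(p-2)/p} n^{1/p} / log² n`, where `(p-2)/p = 1 - 2/p`. -/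
def gap (p : ℝ≥0∞) (n j : ℕ) : ℝ :=
  (j : ℝ) ^ (1 - 2 * invExp p) * (n : ℝ) ^ invExp p / Real.log n ^ 2

/-- The eigenvalues `(λ₁, …, λ_n)` of the example, `n = m + 1`, determined by `λ_n = 3 √n` and
`λ₁ - λ_{j+1} = gap p n j` for `1 ≤ j ≤ n - 1`. -/
def eigs (p : ℝ≥0∞) (m : ℕ) : Fin (m + 1) → ℝ :=
  let lam1 : ℝ := 3 * Real.sqrt ((m + 1 : ℕ) : ℝ) + gap p (m + 1) m
  Matrix.vecCons lam1 (fun j : Fin m => lam1 - gap p (m + 1) (j + 1))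

/-- The vector `d(λ) ∈ ℝ^{n-1}` with entries `1 / (λ₁ - λ_{j+1})`, `1 ≤ j ≤ n - 1`. -/
def dvec {m : ℕ} (lam : Fin (m + 1) → ℝ) : Fin m → ℝ :=
  fun j => 1 / (lam 0 - lam j.succ)

/-- The norm `‖d(λ)‖_{p/(p-2)}`. -/
def dnorm {m : ℕ} (p : ℝ≥0∞) (lam : Fin (m + 1) → ℝ) : ℝ :=
  ‖(WithLp.toLp (normExp p) (dvec lam) : PiLp (normExp p) (fun _ : Fin m => ℝ))‖

/-- `A = diag(λ₁, …, λ_n)`. -/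
def matA (p : ℝ≥0∞) (m : ℕ) : Matrix (Fin (m + 1)) (Fin (m + 1)) ℝ :=
  Matrix.diagonal (eigs p m)

/-- `A₀ = diag(λ₂, …, λ_n)`. -/
def matA0 (p : ℝ≥0∞) (m : ℕ) : Matrix (Fin m) (Fin m) ℝ :=
  Matrix.diagonal (fun j => eigs p m j.succ)

/-- The `(m + 1) × (m + 1)` matrix with zero first row and first column and bottom right
block `G`. -/
def padZero {m : ℕ} (G : Matrix (Fin m) (Fin m) ℝ) : Matrix (Fin (m + 1)) (Fin (m + 1)) ℝ :=
  Matrix.of (Matrix.vecCons 0 (fun j => Matrix.vecCons 0 (G j)))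

end GOEExample

end

namespace GOEExample

/-! Since `A + E` is block diagonal, once `λ_max(A₀ + G) > λ₁` its leading eigenvectors live in the
lower block, while those of `A` are multiples of `e₁`; this is `inner_eq_zero_of_lt_lambdaMax`. The
inequality comes from the Rayleigh quotient of `A₀ + G` at `x = (β, g)`, where `g` is the
off-diagonal first row of `G` (`lt_lambdaMax_of_row`). With `S = |g|²`, the row contributes `2βS`.
The losses are at most `Dβ² + QS` from the gaps and, on a good event, `Lβ² + LS` from the rest of
`G`, where `L = log n`. Taking `β = Q + L` leaves a surplus as soon as `(Q + L)(L + D) < S`. Here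
`S` exceeds a multiple of `n`, whereas `QD = n / log⁴ n` for every `p`. The good event fails with
probability at most `6/n`: given `g`, the form of the remaining block at `g` is Gaussian with
variance `2|g|⁴` (`measure_quadForm_le`). The norm bound reduces to a harmonic sum (`dnorm_eigs`).
-/

/-! ### Top eigenvalue of a symmetric matrix. -/

open Pointwise in
theorem dotProduct_mulVec_le_lambdaMax {k : ℕ} {M : Matrix (Fin k) (Fin k) ℝ}
    (hM : M.IsHermitian) (x : Fin k → ℝ) :
    x ⬝ᵥ (M.mulVec x) ≤ lambdaMax M * (x ⬝ᵥ x) := by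
  have hbdd : BddAbove (spectrum ℝ M) := (Matrix.finite_real_spectrum (A := M)).bddAbove
  -- The spectrum of `λ_max - M` is `λ_max` minus that of `M`, so this matrix is positive
  -- semidefinite.
  obtain ⟨B, hB⟩ : ∃ B, B = algebraMap ℝ (Matrix (Fin k) (Fin k) ℝ) (lambdaMax M) - M := ⟨_, rfl⟩
  have hH : B.IsHermitian := by
    rw [hB, Algebra.algebraMap_eq_smul_one]
    refine Matrix.IsHermitian.sub ?_ hM
    simp [Matrix.IsHermitian]
  have hP : B.PosSemidef := by
    rw [hH.posSemidef_iff_eigenvalues_nonneg]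
    intro i
    have h1 := hH.eigenvalues_mem_spectrum_real i
    have h2 : spectrum ℝ B = ({lambdaMax M} : Set ℝ) - spectrum ℝ M := by
      rw [hB, spectrum.singleton_sub_eq]
    rw [h2] at h1
    obtain ⟨_, rfl, y, hy, h3⟩ := h1
    have := le_csSup hbdd hy
    change y ≤ lambdaMax M at this
    simp only [Pi.zero_apply]
    linarith
  have h := hP.dotProduct_mulVec_nonneg x
  simp only [hB, Algebra.algebraMap_eq_smul_one, star_trivial, Matrix.sub_mulVec,
    Matrix.smul_mulVec, Matrix.one_mulVec, dotProduct_sub, dotProduct_smul, smul_eq_mul] at h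
  linarith

theorem exists_mulVec_eq_lambdaMax {k : ℕ} [NeZero k] {M : Matrix (Fin k) (Fin k) ℝ}
    (hM : M.IsHermitian) : ∃ w : Fin k → ℝ, w ≠ 0 ∧ M.mulVec w = lambdaMax M • w := by
  have h : lambdaMax M ∈ spectrum ℝ M :=
    Set.Nonempty.csSup_mem ⟨_, hM.eigenvalues_mem_spectrum_real 0⟩
      (Matrix.finite_real_spectrum (A := M))
  rw [← Matrix.spectrum_toLin', ← Module.End.hasEigenvalue_iff_mem_spectrum] at h
  obtain ⟨w, hw⟩ := h.exists_hasEigenvector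
  exact ⟨w, hw.2, by simpa using hw.apply_eq_smul⟩

theorem le_lambdaMax_of_mulVec_eq {k : ℕ} {M : Matrix (Fin k) (Fin k) ℝ} {w : Fin k → ℝ} {c : ℝ}
    (hw : w ≠ 0) (h : M.mulVec w = c • w) : c ≤ lambdaMax M := by
  refine le_csSup (Matrix.finite_real_spectrum (A := M)).bddAbove ?_
  rw [← Matrix.spectrum_toLin', ← Module.End.hasEigenvalue_iff_mem_spectrum]
  exact Module.End.hasEigenvalue_of_hasEigenvector (x := w)
    ⟨Module.End.mem_eigenspace_iff.2 (by simpa using h), hw⟩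

theorem IsLeadingEigenvector.mulVec_eq {k : ℕ} {M : Matrix (Fin k) (Fin k) ℝ}
    {v : EuclideanSpace ℝ (Fin k)} (hv : IsLeadingEigenvector M v) :
    M.mulVec v.ofLp = lambdaMax M • v.ofLp := by
  have h := hv.apply_eq_smul
  rw [Matrix.toLpLin_apply] at h
  exact congrArg WithLp.ofLp h

/-! ### Block structure and orthogonality. -/

theorem gap_pos (p : ℝ≥0∞) {n j : ℕ} (hn : 2 ≤ n) (hj : 0 < j) : 0 < gap p n j := by
  have h1 : (1 : ℝ) < n := by exact_mod_cast hn
  have := Real.log_pos h1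
  have hj' : (0 : ℝ) < j := by exact_mod_cast hj
  unfold gap
  positivity

theorem eigs_succ (p : ℝ≥0∞) (m : ℕ) (j : Fin m) :
    eigs p m j.succ = eigs p m 0 - gap p (m + 1) (j + 1) := by
  simp [eigs]

theorem lambdaMax_matA (p : ℝ≥0∞) {m : ℕ} (hm : 1 ≤ m) : lambdaMax (matA p m) = eigs p m 0 := by
  unfold lambdaMax matA
  rw [spectrum_diagonal]
  refine IsGreatest.csSup_eq ⟨⟨0, rfl⟩, ?_⟩
  rintro _ ⟨i, rfl⟩
  refine Fin.cases le_rfl (fun j => ?_) i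
  rw [eigs_succ]
  linarith [gap_pos p (n := m + 1) (j := j + 1) (by omega) (by omega)]

theorem perturbed_mulVec_zero (p : ℝ≥0∞) {m : ℕ} (H : Matrix (Fin m) (Fin m) ℝ)
    (v : Fin (m + 1) → ℝ) :
    (matA p m + padZero H).mulVec v 0 = eigs p m 0 * v 0 := by
  rw [Matrix.add_mulVec, matA, Pi.add_apply, Matrix.mulVec_diagonal]
  simp [padZero, Matrix.mulVec, dotProduct]

theorem perturbed_mulVec_succ (p : ℝ≥0∞) {m : ℕ} (H : Matrix (Fin m) (Fin m) ℝ)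
    (v : Fin (m + 1) → ℝ) (i : Fin m) :
    (matA p m + padZero H).mulVec v i.succ = (matA0 p m + H).mulVec (fun j => v j.succ) i := by
  rw [Matrix.add_mulVec, Matrix.add_mulVec, matA, matA0, Pi.add_apply, Pi.add_apply,
    Matrix.mulVec_diagonal, Matrix.mulVec_diagonal]
  simp [padZero, Matrix.mulVec, dotProduct, Fin.sum_univ_succ]

theorem isHermitian_matA0_add (p : ℝ≥0∞) {m : ℕ} {H : Matrix (Fin m) (Fin m) ℝ}
    (hH : H.IsSymm) : (matA0 p m + H).IsHermitian := by
  refine Matrix.IsHermitian.add (Matrix.isHermitian_diagonal _) ?_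
  rwa [Matrix.IsHermitian, Matrix.conjTranspose_eq_transpose_of_trivial]

/-- Padding an eigenvector of the lower block with a zero puts the top eigenvalue of `A + E` above
`λ₁`; row zero of the eigenvalue equation then forces `v 0 = 0`. Positive gaps kill the other
coordinates of `u`. -/
theorem inner_eq_zero_of_lt_lambdaMax (p : ℝ≥0∞) {m : ℕ} (hm : 1 ≤ m)
    {H : Matrix (Fin m) (Fin m) ℝ} (hH : H.IsSymm)
    (hlt : eigs p m 0 < lambdaMax (matA0 p m + H)) {u v : EuclideanSpace ℝ (Fin (m + 1))}
    (hu : IsLeadingEigenvector (matA p m) u)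
    (hv : IsLeadingEigenvector (matA p m + padZero H) v) : inner ℝ v u = 0 := by
  have : NeZero m := ⟨by omega⟩
  obtain ⟨w, hw0, hw⟩ := exists_mulVec_eq_lambdaMax (isHermitian_matA0_add p hH)
  have hpad : (matA p m + padZero H).mulVec (Fin.cons 0 w)
      = lambdaMax (matA0 p m + H) • (Fin.cons 0 w : Fin (m + 1) → ℝ) := by
    funext i
    refine Fin.cases ?_ (fun j => ?_) i
    · rw [perturbed_mulVec_zero]; simp
    · rw [perturbed_mulVec_succ]; simp [hw]
  have hne : (Fin.cons 0 w : Fin (m + 1) → ℝ) ≠ 0 := by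
    intro h
    exact hw0 (funext fun j => by simpa using congrFun h j.succ)
  have hle := le_lambdaMax_of_mulVec_eq hne hpad
  have hv0 : v.ofLp 0 = 0 := by
    have h := congrFun hv.mulVec_eq 0
    rw [perturbed_mulVec_zero, Pi.smul_apply, smul_eq_mul] at h
    have h2 : (lambdaMax (matA p m + padZero H) - eigs p m 0) * v.ofLp 0 = 0 := by linarith
    exact (mul_eq_zero.1 h2).resolve_left (by linarith)
  have hus : ∀ j : Fin m, u.ofLp j.succ = 0 := by
    intro j
    have h := congrFun hu.mulVec_eq j.succ
    rw [lambdaMax_matA p hm, matA, Matrix.mulVec_diagonal, Pi.smul_apply, smul_eq_mul,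
      eigs_succ] at h
    have h2 : gap p (m + 1) (j + 1) * u.ofLp j.succ = 0 := by linarith
    exact (mul_eq_zero.1 h2).resolve_left (gap_pos p (by omega) (by omega)).ne'
  rw [PiLp.inner_apply, Fin.sum_univ_succ]
  simp [hv0, hus]

/-! ### The test vector. -/

/-- Lower bound for the quadratic form of `A₀ + G` at the test vector `(β, g)`, where `g` is the
off-diagonal part of the first row of `G`. -/
theorem lt_lambdaMax_of_row (p : ℝ≥0∞) {k : ℕ} {H : Matrix (Fin (k + 1)) (Fin (k + 1)) ℝ}
    (hH : H.IsSymm) {L D Q S : ℝ} (hL : 0 < L) (hQ : 0 ≤ Q)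
    (hS : S = ∑ j : Fin k, H 0 j.succ ^ 2)
    (hD : gap p (k + 2) 1 ≤ D)
    (hgap : ∀ j : Fin k, gap p (k + 2) (j + 2) ≤ Q)
    (h00 : -L < H 0 0)
    (hquad : -(L * S) < ∑ i : Fin k, ∑ j : Fin k, H 0 i.succ * H 0 j.succ * H i.succ j.succ)
    (hlarge : (Q + L) * (L + D) < S) :
    eigs p (k + 1) 0 < lambdaMax (matA0 p (k + 1) + H) := by
  set g : Fin k → ℝ := fun j => H 0 j.succ with hg
  -- This choice makes `2βS - QS - LS = βS`, leaving a surplus of at least `β(S - β(L + D))`.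
  set β := Q + L with hβ
  have hβ0 : 0 < β := by positivity
  set x : Fin (k + 1) → ℝ := Fin.cons β g with hx
  have hxx : x ⬝ᵥ x = β ^ 2 + S := by
    simp [hx, dotProduct, Fin.sum_univ_succ, hS, hg, sq]
  have hHx : x ⬝ᵥ H.mulVec x = β ^ 2 * H 0 0 + 2 * β * S
      + ∑ i : Fin k, ∑ j : Fin k, H 0 i.succ * H 0 j.succ * H i.succ j.succ := by
    have hsym : ∀ j : Fin k, H j.succ 0 = g j := fun j => hH.apply 0 j.succ
    simp only [dotProduct, Matrix.mulVec, Fin.sum_univ_succ, hx, Fin.cons_zero, Fin.cons_succ,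
      hsym, mul_add, Finset.sum_add_distrib, hS, Finset.mul_sum]
    have e1 : ∀ j : Fin k, H 0 j.succ = g j := fun j => rfl
    simp only [e1]
    rw [show (∑ i, 2 * β * g i ^ 2) = ∑ i, β * (g i * g i) + ∑ i, g i * (g i * β) by
      rw [← Finset.sum_add_distrib]; exact Finset.sum_congr rfl fun i _ => by ring]
    have e2 : ∀ i j : Fin k, g i * (H i.succ j.succ * g j) = g i * g j * H i.succ j.succ :=
      fun i j => by ring
    simp only [e2]
    ring
  have hAx : eigs p (k + 1) 0 * (β ^ 2 + S) - D * β ^ 2 - Q * S ≤ x ⬝ᵥ (matA0 p (k + 1)).mulVec x := by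
    have e : x ⬝ᵥ (matA0 p (k + 1)).mulVec x = β ^ 2 * (eigs p (k + 1) 0 - gap p (k + 2) 1)
        + ∑ j : Fin k, g j ^ 2 * (eigs p (k + 1) 0 - gap p (k + 2) (j + 2)) := by
      simp only [dotProduct, matA0, Matrix.mulVec_diagonal, Fin.sum_univ_succ, hx, Fin.cons_zero,
        Fin.cons_succ, eigs_succ]
      simp only [Fin.val_zero, Fin.val_succ]
      congr 1
      · ring
      · exact Finset.sum_congr rfl fun i _ => by ring
    have h2 : S * (eigs p (k + 1) 0 - Q)
        ≤ ∑ j : Fin k, g j ^ 2 * (eigs p (k + 1) 0 - gap p (k + 2) (j + 2)) := by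
      rw [hS, Finset.sum_mul]
      exact Finset.sum_le_sum fun j _ =>
        mul_le_mul_of_nonneg_left (by linarith [hgap j]) (sq_nonneg _)
    have h3 := mul_le_mul_of_nonneg_left hD (sq_nonneg β)
    rw [e]
    linarith
  have hray := dotProduct_mulVec_le_lambdaMax (isHermitian_matA0_add p hH) x
  rw [Matrix.add_mulVec, dotProduct_add, hHx, hxx] at hray
  have hS0 : 0 ≤ S := by rw [hS]; positivity
  have h4 : β ^ 2 * (-L) ≤ β ^ 2 * H 0 0 := mul_le_mul_of_nonneg_left h00.le (sq_nonneg _)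
  have h5 : β * (β * (L + D)) < β * S := mul_lt_mul_of_pos_left hlarge hβ0
  have h6 : β * S = Q * S + L * S := by rw [hβ]; ring
  have h7 : eigs p (k + 1) 0 * (β ^ 2 + S) < lambdaMax (matA0 p (k + 1) + H) * (β ^ 2 + S) := by
    nlinarith
  exact lt_of_mul_lt_mul_right h7 (by positivity)

/-! ### The norm of `d(λ)`. -/

theorem invExp_nonneg (p : ℝ≥0∞) : 0 ≤ invExp p := ENNReal.toReal_nonneg

theorem invExp_le_half {p : ℝ≥0∞} (hp : 2 ≤ p) : invExp p ≤ 1 / 2 := by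
  have h : p⁻¹ ≤ 2⁻¹ := ENNReal.inv_le_inv.2 hp
  have := ENNReal.toReal_mono (by simp) h
  simpa [invExp] using this

theorem toReal_inv_normExp {p : ℝ≥0∞} (hp : 2 ≤ p) :
    (normExp p)⁻¹.toReal = 1 - 2 * invExp p := by
  have h : 2 / p ≤ 1 := ENNReal.div_le_of_le_mul (by simpa using hp)
  rw [normExp, inv_inv, ENNReal.toReal_sub_of_le h ENNReal.one_ne_top, invExp, div_eq_mul_inv]
  simp

theorem dvec_eigs (p : ℝ≥0∞) (m : ℕ) (j : Fin m) :
    dvec (eigs p m) j = Real.log (m + 1 : ℕ) ^ 2 / ((m + 1 : ℕ) : ℝ) ^ invExp p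
      * (((j + 1 : ℕ) : ℝ)⁻¹) ^ (1 - 2 * invExp p) := by
  have : dvec (eigs p m) j = 1 / gap p (m + 1) (j + 1) := by simp [dvec, eigs]
  rw [this, gap, Real.inv_rpow (by positivity)]
  field_simp

/-- The norm of `d(λ)` expressed through the harmonic number. -/
theorem dnorm_eigs {p : ℝ≥0∞} (hp : 2 ≤ p) {m : ℕ} (hm : 1 ≤ m) :
    ((m + 1 : ℕ) : ℝ) ^ invExp p * dnorm p (eigs p m)
      = Real.log (m + 1 : ℕ) ^ 2 * (harmonic m : ℝ) ^ (1 - 2 * invExp p) := by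
  have hn : (0 : ℝ) < ((m + 1 : ℕ) : ℝ) := by positivity
  have hna : (0 : ℝ) < ((m + 1 : ℕ) : ℝ) ^ invExp p := by positivity
  set c : ℝ := Real.log (m + 1 : ℕ) ^ 2 / ((m + 1 : ℕ) : ℝ) ^ invExp p with hc
  have hc0 : 0 ≤ c := by positivity
  have hr := toReal_inv_normExp hp
  suffices h : dnorm p (eigs p m) = c * (harmonic m : ℝ) ^ (1 - 2 * invExp p) by
    rw [h, hc]; field_simp
  have hhalf := invExp_le_half hp
  rcases hhalf.eq_or_lt with h2 | h2
  · have hz : 1 - 2 * invExp p = 0 := by rw [h2]; norm_num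
    have htop : normExp p = ∞ := by
      -- `toReal` also sends `∞` to zero, so the case `normExp p = 0` has to be excluded.
      rw [hz, ENNReal.toReal_eq_zero_iff, ENNReal.inv_eq_zero, ENNReal.inv_eq_top] at hr
      refine hr.resolve_right ?_
      rw [normExp, ENNReal.inv_eq_zero]
      exact ENNReal.sub_ne_top ENNReal.one_ne_top
    have : Nonempty (Fin m) := ⟨⟨0, hm⟩⟩
    rw [dnorm, htop, PiLp.norm_eq_ciSup, hz]
    simp only [dvec_eigs, hz, Real.rpow_zero, mul_one, ← hc]
    rw [ciSup_const, Real.norm_of_nonneg hc0]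
  · have hs : 0 < 1 - 2 * invExp p := by linarith
    have hq : (normExp p).toReal = (1 - 2 * invExp p)⁻¹ := by
      rw [← hr, ENNReal.toReal_inv, inv_inv]
    have hq0 : 0 < (normExp p).toReal := by rw [hq]; positivity
    rw [dnorm, PiLp.norm_eq_sum hq0, hq]
    -- The norm exponent is the reciprocal of the power of `j` in the gap, so every `p > 2` yields
    -- the same terms `1/j`.
    have e : ∀ j : Fin m, ‖dvec (eigs p m) j‖ ^ (1 - 2 * invExp p)⁻¹
        = c ^ (1 - 2 * invExp p)⁻¹ * (((j + 1 : ℕ) : ℝ)⁻¹) := by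
      intro j
      rw [dvec_eigs, ← hc, Real.norm_of_nonneg (by positivity),
        Real.mul_rpow hc0 (by positivity), ← Real.rpow_mul (by positivity),
        mul_inv_cancel₀ hs.ne', Real.rpow_one]
    simp only [e]
    rw [← Finset.mul_sum, Fin.sum_univ_eq_sum_range (fun j => (((j + 1 : ℕ) : ℝ)⁻¹)) m,
      show (∑ j ∈ Finset.range m, (((j + 1 : ℕ) : ℝ)⁻¹)) = (harmonic m : ℝ) by simp [harmonic],
      one_div, inv_inv, Real.mul_rpow (by positivity)
        (by exact_mod_cast (harmonic_pos (by omega)).le), ← Real.rpow_mul hc0,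
      inv_mul_cancel₀ hs.ne', Real.rpow_one]

/-- The harmonic number of `n - 1` lies between `log n` and `1 + log (n - 1) ≤ 2 log n`, and the
exponent `1 - 2/p` is in `[0, 1]`, so the factor 2 is uniform in `p`. -/
theorem dnorm_bounds {p : ℝ≥0∞} (hp : 2 ≤ p) {m : ℕ} (hm : 1 ≤ m)
    (hL : 1 ≤ Real.log (m + 1 : ℕ)) :
    Real.log (m + 1 : ℕ) ^ (3 - 2 * invExp p)
        ≤ ((m + 1 : ℕ) : ℝ) ^ invExp p * dnorm p (eigs p m) ∧
      ((m + 1 : ℕ) : ℝ) ^ invExp p * dnorm p (eigs p m)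
        ≤ 2 * Real.log (m + 1 : ℕ) ^ (3 - 2 * invExp p) := by
  rw [dnorm_eigs hp hm]
  have hlow := log_add_one_le_harmonic m
  have hup := harmonic_le_one_add_log m
  have hmon : Real.log m ≤ Real.log (m + 1 : ℕ) :=
    Real.log_le_log (by exact_mod_cast hm) (by push_cast; linarith)
  set L := Real.log (m + 1 : ℕ) with hLdef
  have hL0 : 0 < L := by linarith
  have hs : 0 ≤ 1 - 2 * invExp p := by linarith [invExp_le_half hp]
  have hs1 : 1 - 2 * invExp p ≤ 1 := by linarith [invExp_nonneg p]
  have e : L ^ (3 - 2 * invExp p) = L ^ 2 * L ^ (1 - 2 * invExp p) := by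
    rw [← Real.rpow_natCast L 2, ← Real.rpow_add hL0]; norm_num; ring_nf
  rw [e]
  constructor
  · gcongr
  · have h1 : (harmonic m : ℝ) ^ (1 - 2 * invExp p) ≤ (2 * L) ^ (1 - 2 * invExp p) :=
      Real.rpow_le_rpow (by linarith) (by linarith) hs
    have h2 : (2 : ℝ) ^ (1 - 2 * invExp p) ≤ 2 := by
      simpa using Real.rpow_le_rpow_of_exponent_le (by norm_num : (1 : ℝ) ≤ 2) hs1
    rw [Real.mul_rpow (by norm_num) hL0.le] at h1
    have h3 : 0 ≤ L ^ (1 - 2 * invExp p) := by positivity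
    calc L ^ 2 * (harmonic m : ℝ) ^ (1 - 2 * invExp p)
        ≤ L ^ 2 * (2 * L ^ (1 - 2 * invExp p)) := by gcongr; nlinarith
      _ = _ := by ring

/-! ### Size of the gaps. -/

theorem gap_one (p : ℝ≥0∞) (n : ℕ) :
    gap p n 1 = (n : ℝ) ^ invExp p / Real.log n ^ 2 := by simp [gap]

theorem gap_le {p : ℝ≥0∞} (hp : 2 ≤ p) {n j : ℕ} (hn : 1 ≤ n) (hj : j ≤ n) :
    gap p n j ≤ (n : ℝ) ^ (1 - invExp p) / Real.log n ^ 2 := by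
  have hn0 : (0 : ℝ) < n := by exact_mod_cast hn
  have e : (n : ℝ) ^ (1 - invExp p) = (n : ℝ) ^ (1 - 2 * invExp p) * (n : ℝ) ^ invExp p := by
    rw [← Real.rpow_add hn0]; ring_nf
  rw [e, gap]
  have hs : 0 ≤ 1 - 2 * invExp p := by linarith [invExp_le_half hp]
  gcongr

theorem eventually_gap_small :
    ∀ᶠ n : ℕ in Filter.atTop, 20 ≤ Real.log n ∧ Real.log n ^ 2 ≤ (n : ℝ) / 20 := by
  have h1 : Filter.Tendsto (fun n : ℕ => Real.log n) Filter.atTop Filter.atTop :=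
    Real.tendsto_log_atTop.comp tendsto_natCast_atTop_atTop
  have h2 := ((Real.isLittleO_pow_log_id_atTop (n := 2)).comp_tendsto
    (tendsto_natCast_atTop_atTop (R := ℝ))).bound (show (0 : ℝ) < 1 / 20 by norm_num)
  filter_upwards [h1.eventually_ge_atTop 20, h2] with n hn1 hn2
  refine ⟨hn1, ?_⟩
  simp only [Function.comp, id, norm_pow, Real.norm_eq_abs, sq_abs, Nat.abs_cast] at hn2
  linarith

/-- The powers of `n` in the two factors multiply to `n`. After expansion, three terms are at most
`n/20` each and the fourth at most `n/20⁴`. -/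
theorem gap_product_lt {p : ℝ≥0∞} (hp : 2 ≤ p) {k : ℕ}
    (hL : 20 ≤ Real.log (k + 2 : ℕ))
    (hL2 : Real.log (k + 2 : ℕ) ^ 2 ≤ ((k + 2 : ℕ) : ℝ) / 20) :
    (((k + 2 : ℕ) : ℝ) ^ (1 - invExp p) / Real.log (k + 2 : ℕ) ^ 2 + Real.log (k + 2 : ℕ))
      * (Real.log (k + 2 : ℕ) + gap p (k + 2) 1) < (k : ℝ) / 4 := by
  rw [gap_one]
  set n : ℝ := ((k + 2 : ℕ) : ℝ) with hn
  set L := Real.log (k + 2 : ℕ) with hLdef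
  have hk : (k : ℝ) = n - 2 := by rw [hn]; push_cast; ring
  have hn1 : 1 ≤ n := by rw [hn]; push_cast; linarith [(Nat.cast_nonneg k : (0 : ℝ) ≤ k)]
  have hn0 : 0 < n := by linarith
  have hL0 : 0 < L := by linarith
  have hPQ : n ^ (1 - invExp p) * n ^ invExp p = n := by
    rw [← Real.rpow_add hn0]; simp
  have hP : n ^ invExp p ≤ n := by
    simpa using Real.rpow_le_rpow_of_exponent_le hn1
      (show invExp p ≤ 1 by linarith [invExp_le_half hp])
  have hQ : n ^ (1 - invExp p) ≤ n := by
    simpa using Real.rpow_le_rpow_of_exponent_le hn1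
      (show 1 - invExp p ≤ 1 by linarith [invExp_nonneg p])
  have e : (n ^ (1 - invExp p) / L ^ 2 + L) * (L + n ^ invExp p / L ^ 2)
      = n ^ (1 - invExp p) / L + (n ^ (1 - invExp p) * n ^ invExp p) / L ^ 4 + L ^ 2
        + n ^ invExp p / L := by
    field_simp; ring
  rw [e, hPQ]
  have h1 : n ^ (1 - invExp p) / L ≤ n / 20 := by gcongr
  have h2 : n ^ invExp p / L ≤ n / 20 := by gcongr
  have h3 : n / L ^ 4 ≤ n / 20 ^ 4 := by gcongr
  -- With `L² ≤ n/20` this gives `n ≥ 8000`, which absorbs the shift `k = n - 2`.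
  have h4 : (20 : ℝ) ^ 2 ≤ L ^ 2 := by gcongr
  rw [hk]
  linarith

/-! ### Gaussian concentration. -/

section

variable {Ω : Type*} [MeasurableSpace Ω] {μ : Measure Ω}

theorem hasSubgaussianMGF_of_hasLaw_gaussianReal {X : Ω → ℝ} {v : NNReal}
    (hX : HasLaw X (gaussianReal 0 v) μ) : HasSubgaussianMGF X v μ where
  integrable_exp_mul t := by
    have h := integrable_exp_mul_gaussianReal (μ := 0) (v := v) t
    rw [← hX.map_eq] at h
    exact h.comp_aemeasurable hX.aemeasurable
  mgf_le t := by
    rw [mgf_gaussianReal hX.map_eq]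
    simp

theorem HasSubgaussianMGF.measure_le_neg_le {X : Ω → ℝ} {c : NNReal}
    (h : HasSubgaussianMGF X c μ) {t : ℝ} (ht : 0 ≤ t) :
    μ.real {ω | X ω ≤ -t} ≤ Real.exp (-t ^ 2 / (2 * c)) := by
  have := h.neg.measure_ge_le ht
  simpa only [Pi.neg_apply, le_neg] using this

/-- Fubini bound: if every section of a set is small for the law of `Y`, the event that the
independent pair `(X, Y)` lies in the set is small. -/
theorem IndepFun.measureReal_prod_mem_le {α β : Type*} [MeasurableSpace α] [MeasurableSpace β]
    [IsProbabilityMeasure μ] {X : Ω → α} {Y : Ω → β} (hXY : IndepFun X Y μ)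
    (hX : AEMeasurable X μ) (hY : AEMeasurable Y μ) {s : Set (α × β)} (hs : MeasurableSet s)
    {ε : ℝ} (hε : 0 ≤ ε) (h : ∀ x, μ.real {ω | (x, Y ω) ∈ s} ≤ ε) :
    μ.real {ω | (X ω, Y ω) ∈ s} ≤ ε := by
  have hpm : IsProbabilityMeasure (μ.map X) := Measure.isProbabilityMeasure_map hX
  have hpm' : IsProbabilityMeasure (μ.map Y) := Measure.isProbabilityMeasure_map hY
  refine ENNReal.toReal_le_of_le_ofReal hε ?_
  have e : μ {ω | (X ω, Y ω) ∈ s} = ((μ.map X).prod (μ.map Y)) s := by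
    rw [← (indepFun_iff_map_prod_eq_prod_map_map hX hY).1 hXY,
      Measure.map_apply_of_aemeasurable (hX.prodMk hY) hs]
    rfl
  rw [e, Measure.prod_apply hs]
  calc ∫⁻ x, (μ.map Y) (Prod.mk x ⁻¹' s) ∂(μ.map X)
      ≤ ∫⁻ _, ENNReal.ofReal ε ∂(μ.map X) := by
        refine lintegral_mono fun x => ?_
        rw [Measure.map_apply_of_aemeasurable hY (measurable_prodMk_left hs)]
        exact ENNReal.le_ofReal_iff_toReal_le (measure_ne_top _ _) hε |>.2 (h x)
    _ = ENNReal.ofReal ε := by simp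

/-- Only the entries on and above the diagonal are independent, so quadratic forms are rewritten
over them. -/
theorem sum_sum_eq_sum_upper {k : ℕ} (f : Fin k → Fin k → ℝ) (hf : ∀ i j, f i j = f j i) :
    ∑ i, ∑ j, f i j = ∑ e : {e : Fin k × Fin k // e.1 ≤ e.2},
      (if e.1.1 = e.1.2 then 1 else 2) * f e.1.1 e.1.2 := by
  have h1 : ∑ i, ∑ j, f i j = ∑ e : Fin k × Fin k, f e.1 e.2 := by
    rw [Fintype.sum_prod_type]
  have h2 : ∑ e : Fin k × Fin k with ¬ e.1 ≤ e.2, f e.1 e.2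
      = ∑ e : Fin k × Fin k with e.1 < e.2, f e.1 e.2 := by
    refine Finset.sum_bij' (fun e _ => e.swap) (fun e _ => e.swap) ?_ ?_ ?_ ?_ ?_
    · intro e he; simpa using he
    · intro e he; simpa using he
    · intro e _; simp
    · intro e _; simp
    · intro e _; exact hf _ _
  have h3 : ∑ e : Fin k × Fin k with e.1 < e.2, f e.1 e.2
      = ∑ e : Fin k × Fin k with e.1 ≤ e.2, (if e.1 = e.2 then 0 else 1) * f e.1 e.2 := by
    rw [Finset.sum_filter, Finset.sum_filter]
    refine Finset.sum_congr rfl fun e _ => ?_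
    rcases lt_trichotomy e.1 e.2 with h | h | h
    · simp [h, h.le, h.ne]
    · simp [h]
    · simp [h.not_ge, h.not_gt]
  rw [h1, ← Finset.sum_filter_add_sum_filter_not _ (fun e : Fin k × Fin k => e.1 ≤ e.2), h2, h3,
    ← Finset.sum_add_distrib,
    Finset.sum_subtype (p := fun e : Fin k × Fin k => e.1 ≤ e.2) _ (fun e => by simp)]
  refine Finset.sum_congr rfl fun e _ => ?_
  split_ifs <;> ring

/-- A Gaussian linear combination of the upper triangle of a GOE-type family has subgaussian
constant `2 |g|⁴` when the coefficients come from the quadratic form at `g`. -/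
theorem hasSubgaussianMGF_quadForm {k : ℕ} {Y : {e : Fin k × Fin k // e.1 ≤ e.2} → Ω → ℝ}
    (hind : iIndepFun Y μ)
    (hY : ∀ e, HasLaw (Y e) (gaussianReal 0 (if e.1.1 = e.1.2 then 2 else 1)) μ)
    (g : Fin k → ℝ) {V : NNReal} (hV : (V : ℝ) = 2 * (∑ j, g j ^ 2) ^ 2) :
    HasSubgaussianMGF (fun ω => ∑ e : {e : Fin k × Fin k // e.1 ≤ e.2},
      (if e.1.1 = e.1.2 then 1 else 2) * (g e.1.1 * g e.1.2 * Y e ω))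
      V μ := by
  set c : {e : Fin k × Fin k // e.1 ≤ e.2} → ℝ :=
    fun e => (if e.1.1 = e.1.2 then 1 else 2) * (g e.1.1 * g e.1.2) with hc
  have hind' : iIndepFun (fun e ω => c e * Y e ω) μ :=
    hind.comp (fun e x => c e * x) (fun e => measurable_const_mul _)
  have h := HasSubgaussianMGF.sum_of_iIndepFun hind' (s := Finset.univ) (fun e _ =>
    (hasSubgaussianMGF_of_hasLaw_gaussianReal (hY e)).const_mul (c e))
  have hfun : (fun ω => ∑ e : {e : Fin k × Fin k // e.1 ≤ e.2},
      (if e.1.1 = e.1.2 then 1 else 2) * (g e.1.1 * g e.1.2 * Y e ω))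
      = fun ω => ∑ e, c e * Y e ω := by
    funext ω
    exact Finset.sum_congr rfl fun e _ => by simp only [hc]; ring
  obtain ⟨W, hW, h⟩ : ∃ W : NNReal, (W : ℝ) = ∑ e : {e : Fin k × Fin k // e.1 ≤ e.2},
      c e ^ 2 * (if e.1.1 = e.1.2 then 2 else 1) ∧
      HasSubgaussianMGF (fun ω => ∑ e, c e * Y e ω) W μ := by
    refine ⟨_, ?_, h⟩
    rw [NNReal.coe_sum]
    refine Finset.sum_congr rfl fun e _ => (NNReal.coe_mul _ _).trans ?_
    change c e ^ 2 * _ = _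
    split_ifs <;> simp
  have hVW : V = W := by
    apply NNReal.eq
    have e1 : (2 * (∑ j, g j ^ 2) ^ 2 : ℝ) = ∑ i, ∑ j, 2 * (g i ^ 2 * g j ^ 2) := by
      rw [sq, Finset.sum_mul_sum, Finset.mul_sum]
      simp_rw [Finset.mul_sum]
    -- Diagonal terms have coefficient 1 and variance 2; off-diagonal ones give `2² · 1 = 4`, shared
    -- by two ordered pairs. Either way an ordered pair carries `2 gᵢ² gⱼ²`.
    rw [hV, hW, e1, sum_sum_eq_sum_upper _ (fun i j => by ring)]
    refine Finset.sum_congr rfl fun e _ => ?_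
    simp only [hc]
    split_ifs <;> ring
  rw [hfun, hVW]
  exact h

/-- The Gaussian integral is `1/√3`, and `e < 3`. -/
theorem mgf_sq_gaussian {X : Ω → ℝ} (hX : HasLaw X (gaussianReal 0 1) μ) :
    mgf (fun ω => X ω ^ 2) μ (-1) ≤ Real.exp (-(1 / 2)) := by
  have h1 : mgf (fun ω => X ω ^ 2) μ (-1) = ∫ x, Real.exp (-x ^ 2) ∂(gaussianReal 0 1) := by
    rw [← hX.map_eq, integral_map hX.aemeasurable (by fun_prop)]
    simp [mgf]
  have h2 : ∫ x, Real.exp (-x ^ 2) ∂(gaussianReal 0 1) = √(1 / 3) := by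
    rw [integral_gaussianReal_eq_integral_smul one_ne_zero]
    have e : ∀ x : ℝ, gaussianPDFReal 0 1 x • Real.exp (-x ^ 2)
        = (√(2 * Real.pi))⁻¹ * Real.exp (-(3 / 2) * x ^ 2) := by
      intro x
      simp only [gaussianPDFReal, NNReal.coe_one, mul_one, sub_zero, smul_eq_mul]
      rw [mul_assoc, ← Real.exp_add]
      ring_nf
    simp_rw [e]
    rw [integral_const_mul, integral_gaussian, ← Real.sqrt_inv, ← Real.sqrt_mul (by positivity)]
    congr 1
    field_simp
  rw [h1, h2]
  have h3 : Real.exp (-(1 / 2)) = √(Real.exp (-1)) := by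
    rw [Real.sqrt_eq_rpow, ← Real.exp_mul]; norm_num
  rw [h3]
  apply Real.sqrt_le_sqrt
  rw [Real.exp_neg, ← one_div]
  exact one_div_le_one_div_of_le (Real.exp_pos 1) (by linarith [Real.exp_one_lt_d9])

/-- Chernoff at parameter `-1` gives `e^{k/4} e^{-k/2} = e^{-k/4}`; then `1 + x ≤ eˣ` weakens this
to the order `1/k` that is needed. -/
theorem measure_sum_sq_le {k : ℕ} [IsProbabilityMeasure μ] {X : Fin k → Ω → ℝ}
    (hind : iIndepFun X μ) (hX : ∀ j, HasLaw (X j) (gaussianReal 0 1) μ) :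
    μ.real {ω | ∑ j, X j ω ^ 2 ≤ k / 4} ≤ 4 / (k + 2) := by
  have hmeas : ∀ j, AEMeasurable (X j) μ := fun j => (hX j).aemeasurable
  have hind' : iIndepFun (fun j ω => X j ω ^ 2) μ :=
    hind.comp (fun _ x => x ^ 2) (fun _ => by fun_prop)
  have hint : Integrable (fun ω => Real.exp (-1 * (∑ j, X j ω ^ 2))) μ := by
    refine Integrable.of_bound (C := 1) ?_ ?_
    · exact AEMeasurable.aestronglyMeasurable (by fun_prop)
    · refine Filter.Eventually.of_forall fun ω => ?_
      rw [Real.norm_of_nonneg (Real.exp_pos _).le, Real.exp_le_one_iff]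
      have : 0 ≤ ∑ j, X j ω ^ 2 := by positivity
      linarith
  have h1 := measure_le_le_exp_mul_mgf (k / 4 : ℝ) (by norm_num : (-1 : ℝ) ≤ 0) hint
  have h2 : mgf (fun ω => ∑ j, X j ω ^ 2) μ (-1) ≤ Real.exp (-(k / 2)) := by
    have e : (fun ω => ∑ j, X j ω ^ 2) = ∑ j, fun ω => X j ω ^ 2 := by ext; simp
    rw [e, hind'.mgf_sum₀ (fun j => by fun_prop)]
    calc ∏ j, mgf (fun ω => X j ω ^ 2) μ (-1) ≤ ∏ _j : Fin k, Real.exp (-(1 / 2)) :=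
          Finset.prod_le_prod (fun _ _ => mgf_nonneg) fun j _ => mgf_sq_gaussian (hX j)
      _ = Real.exp (-(k / 2)) := by
          rw [Finset.prod_const, Finset.card_univ, Fintype.card_fin, ← Real.exp_nat_mul]
          ring_nf
  calc _ ≤ _ := h1
    _ ≤ Real.exp (- -1 * (k / 4)) * Real.exp (-(k / 2)) := by gcongr
    _ = (Real.exp (k / 4))⁻¹ := by rw [← Real.exp_add, ← Real.exp_neg]; ring_nf
    _ ≤ ((k + 2) / 4 : ℝ)⁻¹ := by
        gcongr
        linarith [Real.add_one_le_exp (k / 4 : ℝ)]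
    _ = 4 / (k + 2) := by rw [inv_div]

theorem exp_neg_log_sq_le {n : ℕ} (hL : 4 ≤ Real.log n) :
    Real.exp (-Real.log n ^ 2 / 4) ≤ 1 / n := by
  have hn : (0 : ℝ) < n := by
    rcases Nat.eq_zero_or_pos n with rfl | h
    · simp at hL; linarith
    · exact_mod_cast h
  calc _ ≤ Real.exp (-Real.log n) := Real.exp_le_exp.2 (by nlinarith)
    _ = 1 / n := by rw [Real.exp_neg, Real.exp_log hn, one_div]

end

/-! ### The good event for the GOE. -/

section

variable {Ω : Type*} [MeasurableSpace Ω] {μ : Measure Ω}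

/-- The entries of the first row to the right of the diagonal. -/
def rowIndex {k : ℕ} (j : Fin k) : {e : Fin (k + 1) × Fin (k + 1) // e.1 ≤ e.2} :=
  ⟨(0, j.succ), Fin.zero_le _⟩

/-- The upper triangle of the lower right block. -/
def blockIndex {k : ℕ} (e : {e : Fin k × Fin k // e.1 ≤ e.2}) :
    {e : Fin (k + 1) × Fin (k + 1) // e.1 ≤ e.2} :=
  ⟨(e.1.1.succ, e.1.2.succ), Fin.succ_le_succ_iff.2 e.2⟩

theorem rowIndex_injective {k : ℕ} : Function.Injective (rowIndex (k := k)) := by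
  intro i j h
  simpa [rowIndex] using h

theorem blockIndex_injective {k : ℕ} : Function.Injective (blockIndex (k := k)) := by
  rintro ⟨⟨a, b⟩, h⟩ ⟨⟨c, d⟩, h'⟩ h
  simpa [blockIndex] using h

namespace IsGOE

theorem hasLaw_entry {m : ℕ} {G : Ω → Matrix (Fin m) (Fin m) ℝ} (hG : IsGOE G μ) (i j : Fin m) :
    HasLaw (fun ω => G ω i j) (gaussianReal 0 (if i = j then 2 else 1)) μ := by
  split_ifs with h
  · subst h; exact hG.diag i
  · exact hG.offDiag i j h

variable {k : ℕ} {G : Ω → Matrix (Fin (k + 1)) (Fin (k + 1)) ℝ}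

/-- The two families read disjoint sets of upper-triangular entries. -/
theorem indepFun_row_block (hG : IsGOE G μ) :
    IndepFun (fun ω (j : Fin k) => G ω 0 j.succ)
      (fun ω (e : {e : Fin k × Fin k // e.1 ≤ e.2}) => G ω e.1.1.succ e.1.2.succ) μ := by
  classical
  have h := hG.indep.indepFun_finset₀ (Finset.univ.image (rowIndex (k := k)))
    (Finset.univ.image (blockIndex (k := k))) ?_ (fun e => (hG.hasLaw_entry _ _).aemeasurable)
  · exact h.comp
      (φ := fun x (j : Fin k) => x ⟨rowIndex j, Finset.mem_image_of_mem _ (Finset.mem_univ _)⟩)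
      (ψ := fun x e => x ⟨blockIndex e, Finset.mem_image_of_mem _ (Finset.mem_univ _)⟩)
      (by fun_prop) (by fun_prop)
  · rw [Finset.disjoint_left]
    simp only [Finset.mem_image, Finset.mem_univ, true_and, not_exists]
    rintro _ ⟨j, rfl⟩ e he
    have := congrArg (fun x => x.1.1) he
    exact Fin.succ_ne_zero _ this

theorem measure_corner_le [IsProbabilityMeasure μ] (hG : IsGOE G μ) {t : ℝ} (ht : 0 ≤ t) :
    μ.real {ω | G ω 0 0 ≤ -t} ≤ Real.exp (-t ^ 2 / 4) := by
  have h := HasSubgaussianMGF.measure_le_neg_le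
    (hasSubgaussianMGF_of_hasLaw_gaussianReal (hG.diag 0)) ht
  norm_num at h
  exact h

theorem measure_row_le [IsProbabilityMeasure μ] (hG : IsGOE G μ) :
    μ.real {ω | ∑ j : Fin k, G ω 0 j.succ ^ 2 ≤ k / 4} ≤ 4 / (k + 2) :=
  measure_sum_sq_le (hG.indep.precomp rowIndex_injective)
    (fun j => hG.offDiag 0 j.succ (Fin.succ_ne_zero j).symm)

/-- With the row frozen at `g`, the threshold `t|g|²` is `t/√2` standard deviations, a bound free of
`g`. Positivity of `|g|²` is part of the event because at `g = 0` the inequality reads `0 ≤ 0`. -/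
theorem measure_quadForm_le [IsProbabilityMeasure μ] (hG : IsGOE G μ) {t : ℝ} (ht : 0 ≤ t) :
    μ.real {ω | 0 < ∑ j : Fin k, G ω 0 j.succ ^ 2 ∧
      ∑ i : Fin k, ∑ j : Fin k, G ω 0 i.succ * G ω 0 j.succ * G ω i.succ j.succ
        ≤ -(t * ∑ j : Fin k, G ω 0 j.succ ^ 2)} ≤ Real.exp (-t ^ 2 / 4) := by
  have hsum : ∀ (g : Fin k → ℝ) (ω : Ω),
      ∑ i : Fin k, ∑ j : Fin k, g i * g j * G ω i.succ j.succ
        = ∑ e : {e : Fin k × Fin k // e.1 ≤ e.2},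
          (if e.1.1 = e.1.2 then 1 else 2) * (g e.1.1 * g e.1.2 * G ω e.1.1.succ e.1.2.succ) :=
    fun g ω => sum_sum_eq_sum_upper (fun i j => g i * g j * G ω i.succ j.succ) fun i j => by
      rw [(hG.symm ω).apply i.succ j.succ, mul_comm (g i)]
  set s : Set ((Fin k → ℝ) × ({e : Fin k × Fin k // e.1 ≤ e.2} → ℝ)) :=
    {z | 0 < ∑ j, z.1 j ^ 2 ∧ ∑ e : {e : Fin k × Fin k // e.1 ≤ e.2},
      (if e.1.1 = e.1.2 then 1 else 2) * (z.1 e.1.1 * z.1 e.1.2 * z.2 e)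
        ≤ -(t * ∑ j, z.1 j ^ 2)} with hs
  have hsm : MeasurableSet s := by
    rw [hs, Set.ofPred_and]
    exact (measurableSet_lt (by fun_prop) (by fun_prop)).inter
      (measurableSet_le (by fun_prop) (by fun_prop))
  have h := IndepFun.measureReal_prod_mem_le hG.indepFun_row_block
    (aemeasurable_pi_lambda _ fun j => (hG.hasLaw_entry _ _).aemeasurable)
    (aemeasurable_pi_lambda _ fun e => (hG.hasLaw_entry _ _).aemeasurable) hsm
    (Real.exp_pos (-t ^ 2 / 4)).le ?_
  · simp only [hsum _ _]
    exact h
  · intro g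
    by_cases hg : 0 < ∑ j, g j ^ 2
    · have hV : ((2 * (∑ j, (g j ^ 2).toNNReal) ^ 2 : NNReal) : ℝ) = 2 * (∑ j, g j ^ 2) ^ 2 := by
        push_cast
        simp only [Real.coe_toNNReal _ (sq_nonneg _)]
      have hsub := hasSubgaussianMGF_quadForm (hG.indep.precomp blockIndex_injective)
        (fun e => by simpa [blockIndex] using hG.hasLaw_entry e.1.1.succ e.1.2.succ) g
        (V := 2 * (∑ j, (g j ^ 2).toNNReal) ^ 2) hV
      have h1 := HasSubgaussianMGF.measure_le_neg_le hsub
        (t := t * ∑ j, g j ^ 2) (by positivity)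
      have e : -(t * ∑ j, g j ^ 2) ^ 2 / (2 * (2 * (∑ j, g j ^ 2) ^ 2)) = -t ^ 2 / 4 := by
        field_simp; norm_num
      rw [hV, e] at h1
      refine le_trans (measureReal_mono ?_) h1
      intro ω hω
      exact hω.2
    · have : {ω | ((g, fun e : {e : Fin k × Fin k // e.1 ≤ e.2} =>
          G ω e.1.1.succ e.1.2.succ) : (Fin k → ℝ) × _) ∈ s} = ∅ := by
        ext ω; simp only [hs, Set.mem_ofPred_eq, hg, false_and, Set.mem_empty_iff_false]
      rw [this]
      simp [(Real.exp_pos _).le]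

theorem one_sub_le_measure [IsProbabilityMeasure μ] (hG : IsGOE G μ) {p : ℝ≥0∞} (hp : 2 ≤ p)
    (hL : 20 ≤ Real.log (k + 2 : ℕ))
    (hL2 : Real.log (k + 2 : ℕ) ^ 2 ≤ ((k + 2 : ℕ) : ℝ) / 20) :
    1 - 6 / ((k + 2 : ℕ) : ℝ) ≤ μ.real {ω |
      eigs p (k + 1) 0 < lambdaMax (matA0 p (k + 1) + G ω)} := by
  set L := Real.log (k + 2 : ℕ) with hLdef
  have hL0 : 0 < L := by linarith
  set good : Set Ω := {ω | eigs p (k + 1) 0 < lambdaMax (matA0 p (k + 1) + G ω)}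
  set b₁ : Set Ω := {ω | G ω 0 0 ≤ -L}
  set b₂ : Set Ω := {ω | ∑ j : Fin k, G ω 0 j.succ ^ 2 ≤ k / 4}
  set b₃ : Set Ω := {ω | 0 < ∑ j : Fin k, G ω 0 j.succ ^ 2 ∧
      ∑ i : Fin k, ∑ j : Fin k, G ω 0 i.succ * G ω 0 j.succ * G ω i.succ j.succ
        ≤ -(L * ∑ j : Fin k, G ω 0 j.succ ^ 2)}
  have hcover : Set.univ ⊆ good ∪ (b₁ ∪ (b₂ ∪ b₃)) := by
    intro ω _
    by_contra hω
    simp only [Set.mem_union, not_or] at hω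
    obtain ⟨hgood, h1, h2, h3⟩ := hω
    replace h1 : -L < G ω 0 0 := not_le.1 h1
    replace h2 : (k / 4 : ℝ) < ∑ j : Fin k, G ω 0 j.succ ^ 2 := not_le.1 h2
    have hk : (0 : ℝ) ≤ k := Nat.cast_nonneg k
    have h3' := not_le.1 fun h => h3 ⟨by linarith, h⟩
    exact hgood (lt_lambdaMax_of_row p (hG.symm ω) hL0 (by positivity) rfl le_rfl
      (fun j => gap_le hp (by omega) (by omega)) h1 h3' ((gap_product_lt hp hL hL2).trans h2))
  have hb₁ := hG.measure_corner_le hL0.le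
  have hb₂ := hG.measure_row_le
  have hb₃ := hG.measure_quadForm_le hL0.le
  have hexp := exp_neg_log_sq_le (n := k + 2) (by linarith)
  have h1 : (1 : ℝ) ≤ μ.real good + (μ.real b₁ + (μ.real b₂ + μ.real b₃)) := by
    calc (1 : ℝ) = μ.real Set.univ := by simp
      _ ≤ μ.real (good ∪ (b₁ ∪ (b₂ ∪ b₃))) := measureReal_mono hcover
      _ ≤ _ := (measureReal_union_le _ _).trans (by
          gcongr
          exact (measureReal_union_le _ _).trans (by gcongr; exact measureReal_union_le _ _))
  -- The three failures cost `1/n` (corner), `4/n` (row norm) and `1/n` (quadratic form).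
  have e : 6 / ((k + 2 : ℕ) : ℝ) = 1 / ((k + 2 : ℕ) : ℝ) + 4 / (k + 2) + 1 / ((k + 2 : ℕ) : ℝ) := by
    push_cast; ring
  rw [e]
  linarith

end IsGOE

end

end GOEExample

theorem mainTheorem4 :
    ∃ (N : ℕ) (C c₁ c₂ : ℝ), 0 < C ∧ 0 < c₁ ∧ 0 < c₂ ∧
      ∀ (n m : ℕ), n = m + 1 → 2 ≤ n → N < n → ∀ (p : ℝ≥0∞), 2 ≤ p →
        (c₁ * Real.log n ^ (3 - 2 * GOEExample.invExp p)
            ≤ (n : ℝ) ^ GOEExample.invExp p * GOEExample.dnorm p (GOEExample.eigs p m) ∧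
          (n : ℝ) ^ GOEExample.invExp p * GOEExample.dnorm p (GOEExample.eigs p m)
            ≤ c₂ * Real.log n ^ (3 - 2 * GOEExample.invExp p)) ∧
        ∀ (Ω : Type*) [MeasurableSpace Ω] (μ : Measure Ω) [IsProbabilityMeasure μ]
          (G : Ω → Matrix (Fin m) (Fin m) ℝ), GOEExample.IsGOE G μ →
          1 - C / n ≤ μ.real {ω |
            GOEExample.eigs p m 0 < GOEExample.lambdaMax (GOEExample.matA0 p m + G ω) ∧
            ∀ u₁ v₁ : EuclideanSpace ℝ (Fin (m + 1)),
              GOEExample.IsLeadingEigenvector (GOEExample.matA p m) u₁ →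
              GOEExample.IsLeadingEigenvector
                (GOEExample.matA p m + GOEExample.padZero (G ω)) v₁ →
              inner ℝ v₁ u₁ = 0} := by
  obtain ⟨N, hN⟩ := Filter.eventually_atTop.1 GOEExample.eventually_gap_small
  refine ⟨N, 6, 1, 2, by norm_num, by norm_num, by norm_num, ?_⟩
  intro n m hnm hn hNn p hp
  obtain ⟨k, rfl⟩ : ∃ k, m = k + 1 := ⟨m - 1, by omega⟩
  subst hnm
  obtain ⟨hL, hL2⟩ := hN _ hNn.le
  refine ⟨?_, ?_⟩
  · rw [one_mul]
    exact GOEExample.dnorm_bounds hp (by omega) (by linarith)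
  · intro Ω _ μ _ G hG
    refine (hG.one_sub_le_measure hp hL hL2).trans (measureReal_mono ?_)
    intro ω hω
    exact ⟨hω, fun u v hu hv =>
      GOEExample.inner_eq_zero_of_lt_lambdaMax p (by omega) (hG.symm ω) hω hu hv⟩
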